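/- Let $\mathcal U$ be a free ultrafilter on $\mathbb N$. For each $i\in\mathbb N$ let $(M_i,\tau_i)$ be a separable tracial von Neumann algebra, i.e. a von Neumann algebra $M_i$ with a faithful normal tracial state $\tau_i$ such that $M_i$ is separable for the norm $\|x\|_2=\tau_i(x^*x)^{1/2}$. Let $$\mathcal M=\prod_{i\to\mathcal U}M_i=\Big\{(x_i)_i\in\prod_i M_i:\ \sup_i\|x_i\|<\infty\Big\}\Big/\Big\{(x_i)_i:\ \lim_{i\to\mathcal U}\|x_i\|_2=0\Big\}$$ be the tracial ultraproduct, with the trace $\tau_{\mathcal U}([x_i]_i)=\lim_{i\to\mathcal U}\tau_i(x_i)$. A map $\alpha:\mathcal M\to\mathcal M$ is said to lift to a sequence of maps $\phi^i:M_i\to M_i$ with $\sup_i\|\phi^i\|<\infty$ if $\alpha([x_i]_i)=[\phi^i(x_i)]_i$ for every bounded sequence $(x_i)_i$. Suppose that $\alpha:\mathcal M\to\mathcal M$ is a $*$-automorphism with $\tau_{\mathcal U}\circ\alpha=\tau_{\mathcal U}$ that lifts to a sequence of positive linear maps $\phi^i:M_i\to M_i$ with $\sup_i\|\phi^i\|<\infty$.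 Then $\alpha$ also lifts to a sequence of normal positive linear maps $\psi^i:M_i\to M_i$ with $\sup_i\|\psi^i\|<\infty$. -/

import Mathlib

open scoped ComplexOrder
open Filter Topology

universe u

namespace TracialVN

noncomputable section

theorem eq_star_mul_self_of_spectrum_nonneg {A : Type*} [CStarAlgebra A] {x : A}
    (hx : IsSelfAdjoint x) (h : ∀ r ∈ spectrum ℝ x, 0 ≤ r) : ∃ s, x = star s * s := by
  let _ := CStarAlgebra.spectralOrder A
  have _ := CStarAlgebra.spectralOrderedRing A
  exact CStarAlgebra.nonneg_iff_eq_star_mul_self.1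
    ((StarOrderedRing.nonneg_iff_spectrum_nonneg x hx).2 h)

section SingleAlgebra

variable {H : Type u} [NormedAddCommGroup H] [InnerProductSpace ℂ H] [CompleteSpace H]

/-- The type of elements of a von Neumann algebra `M ⊆ B(H)`, with the `*`-algebra operations,
the operator norm and the operator (Loewner) order inherited from `B(H)`. -/
def Elem (M : VonNeumannAlgebra H) : Type u := M.toStarSubalgebra

namespace Elem

variable {M : VonNeumannAlgebra H}

/-- An element of `M` as a bounded operator on `H`. -/
def toCLM (x : Elem M) : H →L[ℂ] H := Subtype.val x

theorem isClosed_coe (M : VonNeumannAlgebra H) :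
    IsClosed (M.toStarSubalgebra : Set (H →L[ℂ] H)) := by
  change IsClosed (M : Set (H →L[ℂ] H))
  rw [← M.centralizer_centralizer]
  exact Set.isClosed_centralizer _

instance : CStarAlgebra (Elem M) where
  __ := (inferInstance : NormedRing M.toStarSubalgebra)
  __ := (inferInstance : StarRing M.toStarSubalgebra)
  __ := (inferInstance : NormedAlgebra ℂ M.toStarSubalgebra)
  __ := (inferInstance : StarModule ℂ M.toStarSubalgebra)
  __ := (inferInstance : CStarRing M.toStarSubalgebra)
  complete := by
    have hc : CompleteSpace M.toStarSubalgebra :=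
      completeSpace_coe_iff_isComplete.2 (isClosed_coe M).isComplete
    exact fun {f} hf => hc.complete hf

instance : PartialOrder (Elem M) := inferInstanceAs (PartialOrder M.toStarSubalgebra)

theorem le_iff {x y : Elem M} : x ≤ y ↔ x.toCLM ≤ y.toCLM := Iff.rfl

theorem toCLM_injective : Function.Injective (toCLM : Elem M → H →L[ℂ] H) :=
  Subtype.val_injective

theorem toCLM_mem (x : Elem M) : x.toCLM ∈ M := x.2

@[simp] theorem toCLM_zero : (0 : Elem M).toCLM = 0 := rfl
@[simp] theorem toCLM_one : (1 : Elem M).toCLM = 1 := rfl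
@[simp] theorem toCLM_add (x y : Elem M) : (x + y).toCLM = x.toCLM + y.toCLM := rfl
@[simp] theorem toCLM_sub (x y : Elem M) : (x - y).toCLM = x.toCLM - y.toCLM := rfl
@[simp] theorem toCLM_mul (x y : Elem M) : (x * y).toCLM = x.toCLM * y.toCLM := rfl
@[simp] theorem toCLM_smul (c : ℂ) (x : Elem M) : (c • x).toCLM = c • x.toCLM := rfl
@[simp] theorem toCLM_star (x : Elem M) : (star x).toCLM = star x.toCLM := rfl
theorem norm_eq (x : Elem M) : ‖x‖ = ‖x.toCLM‖ := rfl

/-- The order inherited from `B(H)` is the intrinsic one: `0 ≤ x` iff `x = s* s` with `s ∈ M`. -/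
instance : StarOrderedRing (Elem M) :=
  StarOrderedRing.of_nonneg_iff'
    (fun {x y} hxy z => le_iff.2 (by
      simpa using! (add_le_add_iff_left z.toCLM).2 (le_iff.1 hxy)))
    (fun x => by
      constructor
      · intro hx
        have hx' : 0 ≤ x.toCLM := le_iff.1 hx
        refine eq_star_mul_self_of_spectrum_nonneg
          (toCLM_injective (IsSelfAdjoint.of_nonneg hx')) fun r hr => ?_
        refine (StarOrderedRing.nonneg_iff_spectrum_nonneg (R := ℝ) x.toCLM
          (IsSelfAdjoint.of_nonneg hx')).1 hx' r ?_
        rw [← spectrum.preimage_algebraMap ℂ] at hr ⊢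
        have := StarSubalgebra.spectrum_eq M.toStarSubalgebra (hS := isClosed_coe M) (a := x)
        exact (Set.ext_iff.1 this _).1 hr
      · rintro ⟨s, rfl⟩
        exact le_iff.2 (star_mul_self_nonneg s.toCLM))

end Elem

/-- A faithful normal tracial state on a von Neumann algebra `M ⊆ B(H)`.  Elements of `M` carry
the operator (Loewner) order, `→ₚ[ℂ]` denotes positive linear maps, and a positive linear map is
normal when it preserves the suprema of (bounded) upward directed sets, which is
`ScottContinuous`. -/
structure FaithfulNormalTrace (M : VonNeumannAlgebra H) where
  /-- the underlying positive linear functional -/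
  toPositiveLinearMap : Elem M →ₚ[ℂ] ℂ
  map_one' : toPositiveLinearMap 1 = 1
  map_mul_comm' : ∀ x y, toPositiveLinearMap (x * y) = toPositiveLinearMap (y * x)
  faithful' : ∀ x, toPositiveLinearMap (star x * x) = 0 → x = 0
  normal' : ScottContinuous toPositiveLinearMap

namespace FaithfulNormalTrace

variable {M : VonNeumannAlgebra H} (τ : FaithfulNormalTrace M)

instance : CoeFun (FaithfulNormalTrace M) (fun _ => Elem M → ℂ) :=
  ⟨fun τ => τ.toPositiveLinearMap⟩

/-- The tracial `2`-norm `‖x‖₂ = τ(x* x)^{1/2}`. -/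
def twoNorm (x : Elem M) : ℝ :=
  Real.sqrt (τ (star x * x)).re

/-- The tracial von Neumann algebra `(M, τ)` is separable: there is a countable subset of `M`
that is dense for the `2`-norm metric (equivalently, `L²(M, τ)` is separable, or the predual
of `M` is separable). -/
def IsSeparable : Prop :=
  ∃ D : Set (Elem M), D.Countable ∧
    ∀ x : Elem M, ∀ ε > 0, ∃ d ∈ D, τ.twoNorm (x - d) < ε

theorem star_mul_self_nonneg' (x : Elem M) : 0 ≤ star x * x :=
  Elem.le_iff.2 (star_mul_self_nonneg x.toCLM)

theorem nonneg {x : Elem M} (hx : 0 ≤ x) : 0 ≤ τ x := by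
  have := τ.toPositiveLinearMap.monotone' hx
  simpa using! this

theorem mono {x y : Elem M} (h : x ≤ y) : τ x ≤ τ y :=
  τ.toPositiveLinearMap.monotone' h

theorem sq_nonneg (x : Elem M) : 0 ≤ (τ (star x * x)).re :=
  (Complex.le_def.1 (τ.nonneg (star_mul_self_nonneg' x))).1

theorem sq_im (x : Elem M) : (τ (star x * x)).im = 0 :=
  (Complex.le_def.1 (τ.nonneg (star_mul_self_nonneg' x))).2.symm

theorem map_star (x : Elem M) : τ (star x) = star (τ x) := by
  have h1 := τ.sq_im (1 + x)
  have h2 := τ.sq_im (1 + Complex.I • x)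
  have h3 := τ.sq_im x
  have h4 := τ.map_one'
  simp only [star_add, star_one, star_smul, add_mul, mul_add, one_mul, mul_one, map_add,
    Complex.add_im, smul_mul_assoc, mul_smul_comm, map_smul, h4, h3] at h1 h2
  simp [h3] at h1 h2
  apply Complex.ext
  · simp; linarith
  · simp; linarith

theorem twoNorm_nonneg (x : Elem M) : 0 ≤ τ.twoNorm x := Real.sqrt_nonneg _

theorem twoNorm_sq (x : Elem M) : τ.twoNorm x ^ 2 = (τ (star x * x)).re :=
  Real.sq_sqrt (τ.sq_nonneg x)

theorem twoNorm_zero : τ.twoNorm 0 = 0 := by simp [twoNorm]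

theorem twoNorm_star (x : Elem M) : τ.twoNorm (star x) = τ.twoNorm x := by
  simp [twoNorm, τ.map_mul_comm' x (star x)]

theorem twoNorm_add_sq_le (x y : Elem M) :
    τ.twoNorm (x + y) ^ 2 ≤ 2 * τ.twoNorm x ^ 2 + 2 * τ.twoNorm y ^ 2 := by
  have h := τ.sq_nonneg (x - y)
  rw [twoNorm_sq, twoNorm_sq, twoNorm_sq]
  simp only [star_add, star_sub, add_mul, mul_add, sub_mul, mul_sub, map_add, map_sub,
    Complex.add_re, Complex.sub_re] at h ⊢
  linarith

theorem twoNorm_mul_le (a x : Elem M) :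
    τ.twoNorm (a * x) ≤ ‖a‖ * τ.twoNorm x := by
  have h : star (a * x) * (a * x) ≤ ((‖a‖ ^ 2 : ℝ) : ℂ) • (star x * x) := by
    have h0 := CStarAlgebra.star_left_conjugate_le_norm_smul (a := x.toCLM)
      (b := star a.toCLM * a.toCLM) (IsSelfAdjoint.star_mul_self _)
    rw [CStarRing.norm_star_mul_self, ← sq] at h0
    rw [Elem.le_iff]
    rw [← Complex.coe_smul] at h0
    simpa [mul_assoc, Elem.norm_eq] using h0
  have h2 := (Complex.le_def.1 (τ.mono h)).1
  rw [map_smul, smul_eq_mul, Complex.re_ofReal_mul, ← twoNorm_sq, ← twoNorm_sq, ← mul_pow] at h2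
  exact le_of_sq_le_sq h2 (mul_nonneg (norm_nonneg _) (τ.twoNorm_nonneg x))

theorem norm_le_twoNorm (x : Elem M) : ‖τ x‖ ≤ τ.twoNorm x := by
  have h := τ.sq_nonneg (x - τ x • 1)
  have h4 := τ.map_one'
  simp only [star_sub, star_smul, star_one, sub_mul, mul_sub, map_sub, smul_mul_assoc,
    mul_smul_comm, one_mul, mul_one, map_smul, smul_eq_mul, h4, map_star,
    Complex.sub_re] at h
  refine le_of_sq_le_sq ?_ (τ.twoNorm_nonneg x)
  rw [twoNorm_sq, ← Complex.normSq_eq_norm_sq, Complex.normSq_apply]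
  simp at h
  linarith

theorem twoNorm_le_norm (x : Elem M) : τ.twoNorm x ≤ ‖x‖ := by
  have h := τ.twoNorm_mul_le x 1
  have h4 := τ.map_one'
  simpa [twoNorm, h4] using h

end FaithfulNormalTrace

end SingleAlgebra

section Ultraproduct

variable {H : ℕ → Type u} [∀ i, NormedAddCommGroup (H i)] [∀ i, InnerProductSpace ℂ (H i)]
  [∀ i, CompleteSpace (H i)]

/-- The `*`-subalgebra of the full product formed by the operator norm bounded sequences `(xᵢ)` with `xᵢ ∈ Mᵢ`. -/
def boundedSeqSubalgebra (M : ∀ i, VonNeumannAlgebra (H i)) :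
    StarSubalgebra ℂ (∀ i, Elem (M i)) where
  carrier := {x | ∃ C : ℝ, ∀ i, ‖x i‖ ≤ C}
  mul_mem' := by
    rintro x y ⟨C, hC⟩ ⟨D, hD⟩
    exact ⟨C * D, fun i => (norm_mul_le _ _).trans
      (mul_le_mul (hC i) (hD i) (norm_nonneg _) ((norm_nonneg _).trans (hC i)))⟩
  add_mem' := by
    rintro x y ⟨C, hC⟩ ⟨D, hD⟩
    exact ⟨C + D, fun i => (norm_add_le _ _).trans (add_le_add (hC i) (hD i))⟩
  algebraMap_mem' := by
    intro r
    refine ⟨‖r‖, fun i => ?_⟩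
    have h1 : ‖(1 : Elem (M i))‖ ≤ 1 := ContinuousLinearMap.norm_id_le
    rw [Pi.algebraMap_apply, Algebra.algebraMap_eq_smul_one, norm_smul]
    exact mul_le_of_le_one_right (norm_nonneg _) h1
  star_mem' := by
    rintro x ⟨C, hC⟩
    exact ⟨C, fun i => by simpa using! hC i⟩

/-- The `*`-algebra of operator norm bounded sequences `(xᵢ)` with `xᵢ ∈ Mᵢ`, with the
coordinatewise operations. -/
def BoundedSeq (M : ∀ i, VonNeumannAlgebra (H i)) : Type u := boundedSeqSubalgebra M

namespace BoundedSeq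

variable {M : ∀ i, VonNeumannAlgebra (H i)}

instance : Ring (BoundedSeq M) := inferInstanceAs (Ring (boundedSeqSubalgebra M))

instance : Star (BoundedSeq M) := ⟨fun x => ⟨star x.1, (boundedSeqSubalgebra M).star_mem' x.2⟩⟩

instance : StarRing (BoundedSeq M) where
  star_involutive x := Subtype.ext (star_star x.1)
  star_mul x y := Subtype.ext (star_mul x.1 y.1)
  star_add x y := Subtype.ext (star_add x.1 y.1)

instance : Algebra ℂ (BoundedSeq M) := inferInstanceAs (Algebra ℂ (boundedSeqSubalgebra M))

instance : StarModule ℂ (BoundedSeq M) where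
  star_smul c x := Subtype.ext (star_smul c x.1)

instance : CoeFun (BoundedSeq M) (fun _ => ∀ i, Elem (M i)) := ⟨Subtype.val⟩

theorem bounded (x : BoundedSeq M) : ∃ C : ℝ, ∀ i, ‖x i‖ ≤ C := x.2

@[ext] theorem ext {x y : BoundedSeq M} (h : ∀ i, x i = y i) : x = y := Subtype.ext (funext h)

@[simp] theorem zero_apply (i : ℕ) : (0 : BoundedSeq M) i = 0 := rfl
@[simp] theorem one_apply (i : ℕ) : (1 : BoundedSeq M) i = 1 := rfl
@[simp] theorem add_apply (x y : BoundedSeq M) (i : ℕ) : (x + y) i = x i + y i := rfl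
@[simp] theorem sub_apply (x y : BoundedSeq M) (i : ℕ) : (x - y) i = x i - y i := rfl
@[simp] theorem mul_apply (x y : BoundedSeq M) (i : ℕ) : (x * y) i = x i * y i := rfl
@[simp] theorem smul_apply (c : ℂ) (x : BoundedSeq M) (i : ℕ) : (c • x) i = c • x i := rfl
@[simp] theorem star_apply (x : BoundedSeq M) (i : ℕ) : (star x) i = star (x i) := rfl

end BoundedSeq

variable (M : ∀ i, VonNeumannAlgebra (H i)) (τ : ∀ i, FaithfulNormalTrace (M i))
  (𝒰 : Ultrafilter ℕ)

/-- The ideal of bounded sequences with `lim_{i → 𝒰} ‖xᵢ‖₂ = 0`. -/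
def nullIdeal : Ideal (BoundedSeq M) where
  carrier := {x | Tendsto (fun i => (τ i).twoNorm (x i)) 𝒰 (𝓝 0)}
  zero_mem' := by
    have : (fun i => (τ i).twoNorm ((0 : BoundedSeq M) i)) = fun _ => 0 := by
      funext i; exact (τ i).twoNorm_zero
    simp only [Set.mem_ofPred_eq, this]
    exact tendsto_const_nhds
  add_mem' := by
    intro x y hx hy
    simp only [Set.mem_ofPred_eq] at hx hy ⊢
    have h : Tendsto (fun i => Real.sqrt (2 * (τ i).twoNorm (x i) ^ 2
        + 2 * (τ i).twoNorm (y i) ^ 2)) 𝒰 (𝓝 0) := by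
      have := (((hx.pow 2).const_mul 2).add ((hy.pow 2).const_mul 2)).sqrt
      simpa using this
    exact squeeze_zero (fun i => (τ i).twoNorm_nonneg _)
      (fun i => Real.le_sqrt_of_sq_le ((τ i).twoNorm_add_sq_le _ _)) h
  smul_mem' := by
    rintro ⟨a, C, hC⟩ x hx
    simp only [Set.mem_ofPred_eq] at hx ⊢
    refine squeeze_zero (fun i => (τ i).twoNorm_nonneg _) (fun i => ?_)
      (by simpa using hx.const_mul C)
    exact ((τ i).twoNorm_mul_le _ _).trans
      (mul_le_mul_of_nonneg_right (hC i) ((τ i).twoNorm_nonneg _))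

theorem mem_nullIdeal {x : BoundedSeq M} :
    x ∈ nullIdeal M τ 𝒰 ↔ Tendsto (fun i => (τ i).twoNorm (x i)) 𝒰 (𝓝 0) := Iff.rfl

theorem star_mem_nullIdeal {x : BoundedSeq M} (hx : x ∈ nullIdeal M τ 𝒰) :
    star x ∈ nullIdeal M τ 𝒰 := by
  rw [mem_nullIdeal] at hx ⊢
  refine hx.congr fun i => ?_
  exact ((τ i).twoNorm_star _).symm

instance : (nullIdeal M τ 𝒰).IsTwoSided where
  mul_mem_of_left {x} b hx := by
    have h := (nullIdeal M τ 𝒰).mul_mem_left (star b) (star_mem_nullIdeal M τ 𝒰 hx)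
    simpa using star_mem_nullIdeal M τ 𝒰 h

/-- The tracial ultraproduct `∏_{i → 𝒰} (Mᵢ, τᵢ)`: bounded sequences modulo the sequences that
tend to `0` along `𝒰` in `2`-norm. -/
def Ultraproduct : Type u := BoundedSeq M ⧸ nullIdeal M τ 𝒰

namespace Ultraproduct

instance : Ring (Ultraproduct M τ 𝒰) :=
  inferInstanceAs (Ring (BoundedSeq M ⧸ nullIdeal M τ 𝒰))

instance : Algebra ℂ (Ultraproduct M τ 𝒰) :=
  inferInstanceAs (Algebra ℂ (BoundedSeq M ⧸ nullIdeal M τ 𝒰))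

/-- The class `[xᵢ]ᵢ` of a bounded sequence in the ultraproduct. -/
def mk : BoundedSeq M →ₐ[ℂ] Ultraproduct M τ 𝒰 :=
  Ideal.Quotient.mkₐ ℂ (nullIdeal M τ 𝒰)

theorem mk_surjective : Function.Surjective (mk M τ 𝒰) :=
  Ideal.Quotient.mk_surjective

theorem mk_eq_mk_iff {x y : BoundedSeq M} :
    mk M τ 𝒰 x = mk M τ 𝒰 y ↔
      Tendsto (fun i => (τ i).twoNorm (x i - y i)) 𝒰 (𝓝 0) :=
  Ideal.Quotient.eq

/-- `[xᵢ]ᵢ* = [xᵢ*]ᵢ`. -/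
instance : Star (Ultraproduct M τ 𝒰) where
  star := Quotient.map' star (by
    intro x y h
    rw [Submodule.quotientRel_def] at h ⊢
    rw [← star_sub]
    exact star_mem_nullIdeal M τ 𝒰 h)

theorem star_mk (x : BoundedSeq M) : star (mk M τ 𝒰 x) = mk M τ 𝒰 (star x) := rfl

instance : StarRing (Ultraproduct M τ 𝒰) where
  star_involutive z := by
    obtain ⟨x, rfl⟩ := mk_surjective M τ 𝒰 z
    rw [star_mk, star_mk, star_star]
  star_mul z w := by
    obtain ⟨x, rfl⟩ := mk_surjective M τ 𝒰 z
    obtain ⟨y, rfl⟩ := mk_surjective M τ 𝒰 w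
    rw [← map_mul, star_mk, star_mk, star_mk, star_mul, map_mul]
  star_add z w := by
    obtain ⟨x, rfl⟩ := mk_surjective M τ 𝒰 z
    obtain ⟨y, rfl⟩ := mk_surjective M τ 𝒰 w
    rw [← map_add, star_mk, star_mk, star_mk, star_add, map_add]

instance : StarModule ℂ (Ultraproduct M τ 𝒰) where
  star_smul c z := by
    obtain ⟨x, rfl⟩ := mk_surjective M τ 𝒰 z
    rw [← map_smul, star_mk, star_mk, star_smul, map_smul]

end Ultraproduct

theorem exists_tendsto_trace (x : BoundedSeq M) :
    ∃ c : ℂ, Tendsto (fun i => τ i (x i)) 𝒰 (𝓝 c) := by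
  obtain ⟨x, C, hC⟩ := x
  have h := (isCompact_closedBall (0 : ℂ) C).ultrafilter_le_nhds
    (𝒰.map (fun i => τ i (x i))) (by
      simp only [Ultrafilter.coe_map, le_principal_iff, mem_map]
      refine univ_mem' fun i => ?_
      simpa using ((τ i).norm_le_twoNorm _).trans (((τ i).twoNorm_le_norm _).trans (hC i)))
  obtain ⟨c, -, hc⟩ := h
  exact ⟨c, hc⟩

/-- The trace `τ_𝒰([xᵢ]ᵢ) = lim_{i → 𝒰} τᵢ(xᵢ)` on the ultraproduct. -/
def Ultraproduct.trace : Ultraproduct M τ 𝒰 → ℂ :=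
  Quotient.lift (fun x : BoundedSeq M => limUnder (𝒰 : Filter ℕ) (fun i => τ i (x i))) (by
    intro x y h
    replace h : x - y ∈ nullIdeal M τ 𝒰 := (Submodule.quotientRel_def _).1 h
    obtain ⟨c, hc⟩ := exists_tendsto_trace M τ 𝒰 x
    have h0 : Tendsto (fun i => τ i ((x - y) i)) 𝒰 (𝓝 0) :=
      squeeze_zero_norm (fun i => (τ i).norm_le_twoNorm _) h
    have hd : Tendsto (fun i => τ i (y i)) 𝒰 (𝓝 c) := by
      have := hc.sub h0
      rw [sub_zero] at this
      refine this.congr fun i => ?_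
      have e : (x - y) i = x i - y i := rfl
      rw [e, map_sub]; ring
    exact hc.limUnder_eq.trans hd.limUnder_eq.symm)

theorem Ultraproduct.tendsto_trace (x : BoundedSeq M) :
    Tendsto (fun i => τ i (x i)) 𝒰 (𝓝 (Ultraproduct.trace M τ 𝒰 (Ultraproduct.mk M τ 𝒰 x))) :=
  tendsto_nhds_limUnder (exists_tendsto_trace M τ 𝒰 x)

variable {M τ 𝒰}

/-- The sequence of positive maps `φ i : Mᵢ → Mᵢ` is uniformly bounded: `supᵢ ‖φ i‖ < ∞`. -/
def UniformlyBounded (φ : ∀ i, Elem (M i) →ₚ[ℂ] Elem (M i)) : Prop :=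
  ∃ C : ℝ, ∀ i, ∀ x : Elem (M i), ‖φ i x‖ ≤ C * ‖x‖

/-- The map `α` on the ultraproduct lifts to the sequence `φ`: for every bounded sequence `(xᵢ)`
the sequence `(φ i xᵢ)` is bounded and `α([xᵢ]ᵢ) = [φ i xᵢ]ᵢ`. -/
def IsLift (α : Ultraproduct M τ 𝒰 → Ultraproduct M τ 𝒰)
    (φ : ∀ i, Elem (M i) →ₚ[ℂ] Elem (M i)) : Prop :=
  ∀ x : BoundedSeq M, ∃ y : BoundedSeq M, (∀ i, y i = φ i (x i)) ∧
    α (Ultraproduct.mk M τ 𝒰 x) = Ultraproduct.mk M τ 𝒰 y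

end Ultraproduct

end

end TracialVN

namespace TracialVN

/-! Each `φ i` is compressed by a positive contraction `a i`, giving `ψ i z = φ i (a i * z * a i)`.
If `a i → 1` in 2-norm, then `[a i] = 1` in the ultraproduct, so `[a i * x i * a i] = [x i]` and `ψ`
lifts the same `α`.

Normality of `ψ i` follows from a bound `τ (ψ i z) ≤ K * τ z` on positive `z`, where `K` may depend
on `i`: if `d` increases to `s`, then `τ (ψ i (s - d))` becomes arbitrarily small, and faithfulness
of the trace turns this into an operator inequality (`scottContinuous_of_le`).

To find `a i`, let `f = τ ∘ φ i` and take a maximal positive contraction `x` with `K * τ x ≤ f x`.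
Then `τ x ≤ f 1 / K` is small for large `K`, and maximality forces `f ≤ K * τ` below `1 - x`. The
square root of `1 - x` is the required contraction (`exists_le_mul_trace`, `exists_contraction`). -/

theorem mul_self_le_self {A : Type*} [CStarAlgebra A] [PartialOrder A] [StarOrderedRing A]
    {e : A} (h0 : 0 ≤ e) (h1 : e ≤ 1) : e * e ≤ e := by
  have hs : IsSelfAdjoint (CFC.sqrt e) := .of_nonneg (CFC.sqrt_nonneg e)
  have hm : CFC.sqrt e * CFC.sqrt e = e := CFC.sqrt_mul_sqrt_self e h0
  have h := hs.conjugate_le_conjugate h1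
  generalize CFC.sqrt e = r at *
  subst hm
  simpa [mul_assoc] using h

/-! ### Strong limits and suprema of directed sets. -/

theorem nonneg_of_tendsto_apply {H : Type*} [NormedAddCommGroup H] [InnerProductSpace ℂ H]
    {ι : Type*} {l : Filter ι} [l.NeBot] {g : ι → H →L[ℂ] H}
    {s : H →L[ℂ] H} (hg : ∀ᶠ d in l, 0 ≤ g d)
    (h : ∀ ξ, Tendsto (fun d => g d ξ) l (𝓝 (s ξ))) : 0 ≤ s := by
  rw [ContinuousLinearMap.nonneg_iff_isPositive, ContinuousLinearMap.isPositive_iff_complex]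
  intro ξ
  have hl : Tendsto (fun d => (inner ℂ (g d ξ) ξ : ℂ)) l (𝓝 (inner ℂ (s ξ) ξ)) :=
    (h ξ).inner tendsto_const_nhds
  have hc : (0 : ℂ) ≤ inner ℂ (s ξ) ξ := by
    refine ge_of_tendsto hl (hg.mono fun d hd => ?_)
    exact ((ContinuousLinearMap.nonneg_iff_isPositive _).1 hd).inner_nonneg_left ξ
  rw [Complex.le_def] at hc
  exact ⟨Complex.ext (by simp) (by simpa using hc.2), hc.1⟩

section

variable {H : Type u} [NormedAddCommGroup H] [InnerProductSpace ℂ H] [CompleteSpace H]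

/-- From `e² ≤ e`. Applied to differences `d - d₀`, it upgrades convergence of quadratic forms to
norm convergence of vectors. -/
theorem norm_apply_sq_le_of_nonneg_of_le_one {e : H →L[ℂ] H} (h0 : 0 ≤ e) (h1 : e ≤ 1) (ξ : H) :
    ‖e ξ‖ ^ 2 ≤ (inner ℂ (e ξ) ξ).re := by
  have h := (ContinuousLinearMap.le_def _ _).1 (mul_self_le_self h0 h1)
  have hp := h.re_inner_nonneg_left ξ
  have hs := ((ContinuousLinearMap.nonneg_iff_isPositive e).1 h0).inner_left_eq_inner_right (e ξ) ξ
  have h2 : (inner ℂ (e (e ξ)) ξ).re = ‖e ξ‖ ^ 2 := by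
    rw [hs]
    exact inner_self_eq_norm_sq (𝕜 := ℂ) (e ξ)
  simp only [sub_apply, inner_sub_left, map_sub, RCLike.re_to_complex] at hp
  exact h2 ▸ sub_nonneg.1 hp

/-- Directed sets of positive contractions converge strongly. -/
theorem exists_tendsto_apply_of_directedOn {D : Set (H →L[ℂ] H)} (hne : D.Nonempty)
    (hdir : DirectedOn (· ≤ ·) D) (h0 : ∀ d ∈ D, 0 ≤ d) (h1 : ∀ d ∈ D, d ≤ 1) (ξ : H) :
    ∃ η, Tendsto (fun d : D => d.1 ξ) atTop (𝓝 η) := by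
  have : Nonempty D := hne.to_subtype
  have : IsDirectedOrder D := ⟨hdir.directed_val⟩
  have hmono : Monotone fun d : D => (inner ℂ (d.1 ξ) ξ).re := by
    intro d d' h
    have := ((ContinuousLinearMap.le_def d.1 d'.1).1 h).re_inner_nonneg_left ξ
    simpa [inner_sub_left] using this
  have hbdd : BddAbove (Set.range fun d : D => (inner ℂ (d.1 ξ) ξ).re) := by
    refine ⟨(inner ℂ ξ ξ).re, ?_⟩
    rintro _ ⟨d, rfl⟩
    have := ((ContinuousLinearMap.le_def d.1 1).1 (h1 d d.2)).re_inner_nonneg_left ξ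
    simpa [inner_sub_left] using this
  refine CompleteSpace.complete (f := map (fun d : D => d.1 ξ) atTop)
    (Metric.cauchy_iff.2 ⟨inferInstance, fun ε hε => ?_⟩)
  -- Beyond `d₀` the quadratic form moves by less than `(ε / 2)²`, hence the vectors by less than `ε
  -- / 2`.
  obtain ⟨d₀, hd₀⟩ := exists_lt_of_lt_ciSup (sub_lt_self (⨆ d : D, (inner ℂ (d.1 ξ) ξ).re)
    (show 0 < (ε / 2) ^ 2 by positivity))
  have key : ∀ d : D, d₀ ≤ d → ‖d.1 ξ - d₀.1 ξ‖ < ε / 2 := by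
    intro d hd
    have h := norm_apply_sq_le_of_nonneg_of_le_one (e := d.1 - d₀.1) (sub_nonneg.2 hd)
      ((sub_le_self _ (h0 _ d₀.2)).trans (h1 _ d.2)) ξ
    have hs := le_ciSup hbdd d
    simp only [sub_apply, inner_sub_left, Complex.sub_re] at h
    refine lt_of_pow_lt_pow_left₀ 2 (by positivity) ?_
    linarith
  refine ⟨(fun d : D => d.1 ξ) '' Set.Ici d₀, image_mem_map (Ici_mem_atTop d₀), ?_⟩
  rintro _ ⟨d, hd, rfl⟩ _ ⟨d', hd', rfl⟩
  have e1 := key d hd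
  have e2 := key d' hd'
  rw [dist_eq_norm, ← sub_sub_sub_cancel_right _ _ (d₀.1 ξ)]
  exact (norm_sub_le _ _).trans_lt (by linarith)

/-- The supremum is the strong limit, which stays in `M` because `M` equals its bicommutant. -/
theorem Elem.exists_isLUB {M : VonNeumannAlgebra H} {D : Set (Elem M)} (hne : D.Nonempty)
    (hdir : DirectedOn (· ≤ ·) D) (h0 : ∀ d ∈ D, 0 ≤ d) (h1 : ∀ d ∈ D, d ≤ 1) :
    ∃ s, IsLUB D s := by
  have hdir' : DirectedOn (· ≤ ·) (Elem.toCLM '' D) := by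
    rintro _ ⟨x, hx, rfl⟩ _ ⟨y, hy, rfl⟩
    obtain ⟨z, hz, hxz, hyz⟩ := hdir x hx y hy
    exact ⟨_, ⟨z, hz, rfl⟩, hxz, hyz⟩
  have h0' : ∀ d ∈ Elem.toCLM '' D, 0 ≤ d := by
    rintro _ ⟨x, hx, rfl⟩; exact Elem.le_iff.1 (h0 x hx)
  have h1' : ∀ d ∈ Elem.toCLM '' D, d ≤ 1 := by
    rintro _ ⟨x, hx, rfl⟩; exact Elem.le_iff.1 (h1 x hx)
  have hne' := hne.image Elem.toCLM
  generalize hE : Elem.toCLM '' D = E at hdir' h0' h1' hne'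
  have : Nonempty E := hne'.to_subtype
  have : IsDirectedOrder E := ⟨hdir'.directed_val⟩
  choose f hf using exists_tendsto_apply_of_directedOn hne' hdir' h0' h1'
  have hf' : Tendsto (fun (d : E) ξ => (d.1 : H →ₗ[ℂ] H) ξ) atTop (𝓝 f) := tendsto_pi_nhds.2 hf
  have hnorm : ∀ ξ, ‖f ξ‖ ≤ 1 * ‖ξ‖ := fun ξ => le_of_tendsto (hf ξ).norm <|
    Eventually.of_forall fun d => d.1.le_of_opNorm_le
      ((CStarAlgebra.norm_le_one_iff_of_nonneg _ (h0' d d.2)).2 (h1' d d.2)) ξ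
  let s : H →L[ℂ] H := (linearMapOfTendsto f (fun d : E => (d.1 : H →ₗ[ℂ] H)) hf').mkContinuous 1
    hnorm
  have hs : ∀ ξ, Tendsto (fun d : E => d.1 ξ) atTop (𝓝 (s ξ)) := hf
  have hsM : s ∈ M := by
    rw [← SetLike.mem_coe, ← M.centralizer_centralizer]
    intro z hz
    ext ξ
    refine tendsto_nhds_unique ((z.continuous.tendsto _).comp (hs ξ)) ((hs (z ξ)).congr fun d => ?_)
    obtain ⟨x, -, hx⟩ : d.1 ∈ Elem.toCLM '' D := hE ▸ d.2
    have := hz x.toCLM x.toCLM_mem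
    rw [hx] at this
    exact congrArg (fun T : H →L[ℂ] H => T ξ) this
  refine ⟨⟨s, hsM⟩, fun x hx => ?_, fun b hb => ?_⟩
  · refine Elem.le_iff.2 (sub_nonneg.1 ?_)
    have hxE : x.toCLM ∈ E := hE ▸ ⟨x, hx, rfl⟩
    refine nonneg_of_tendsto_apply (l := atTop) (g := fun d : E => d.1 - x.toCLM)
      ((eventually_ge_atTop (⟨_, hxE⟩ : E)).mono fun d hd => sub_nonneg.2 hd) fun ξ => ?_
    exact (hs ξ).sub_const _
  · refine Elem.le_iff.2 (sub_nonneg.1 ?_)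
    refine nonneg_of_tendsto_apply (l := atTop) (g := fun d : E => b.toCLM - d.1)
      (Eventually.of_forall fun d => sub_nonneg.2 ?_) fun ξ => ?_
    · obtain ⟨x, hxD, hx⟩ : d.1 ∈ Elem.toCLM '' D := hE ▸ d.2
      exact hx ▸ Elem.le_iff.1 (hb hxD)
    · exact (hs ξ).const_sub _

end

/-! ### Normality and domination by a trace. -/

theorem _root_.PositiveLinearMap.re_nonneg {A : Type*} [AddCommGroup A] [PartialOrder A] [Module ℂ A]
    (f : A →ₚ[ℂ] ℂ) {x : A} (hx : 0 ≤ x) : 0 ≤ (f x).re :=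
  (Complex.le_def.1 (f.map_nonneg hx)).1

theorem _root_.PositiveLinearMap.re_mono {A : Type*} [AddCommGroup A] [PartialOrder A] [Module ℂ A]
    (f : A →ₚ[ℂ] ℂ) {x y : A} (h : x ≤ y) : (f x).re ≤ (f y).re :=
  (Complex.le_def.1 (f.monotone' h)).1

theorem exists_lt_re_of_isLUB {A : Type*} [AddCommGroup A] [PartialOrder A] [Module ℂ A]
    (τ : A →ₚ[ℂ] ℂ) {D : Set A} (hne : D.Nonempty)
    (hdir : DirectedOn (· ≤ ·) D) {s : A} (hs : IsLUB D s)
    (hn : ScottContinuous τ) {δ : ℝ} (hδ : 0 < δ) :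
    ∃ d ∈ D, (τ s).re - δ < (τ d).re := by
  by_contra! h
  -- The order on `ℂ` also requires equal imaginary parts; these agree since `τ d ≤ τ s`.
  have hub : τ s - δ ∈ upperBounds (τ '' D) := by
    rintro _ ⟨d, hd, rfl⟩
    refine Complex.le_def.2 ⟨by simpa using h d hd, ?_⟩
    simpa using (Complex.le_def.1 (τ.monotone' (hs.1 hd))).2
  have := (Complex.le_def.1 ((hn hne hdir hs).2 hub)).1
  simp at this
  linarith

section

variable {A : Type*} [CStarAlgebra A] [PartialOrder A] [StarOrderedRing A]

variable (τ : A →ₚ[ℂ] ℂ)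

/-- Conjugation by an element with `a² ≤ 1` does not increase a trace. -/
theorem re_conj_le (ht : ∀ x y, τ (x * y) = τ (y * x)) {a z : A} (ha : a * a ≤ 1) (hz : 0 ≤ z) :
    (τ (a * z * a)).re ≤ (τ z).re := by
  have hs : IsSelfAdjoint (CFC.sqrt z) := .of_nonneg (CFC.sqrt_nonneg z)
  have hm : CFC.sqrt z * CFC.sqrt z = z := CFC.sqrt_mul_sqrt_self z hz
  have h := τ.re_mono (hs.conjugate_le_conjugate ha)
  rw [mul_one, hm] at h
  refine le_of_eq_of_le ?_ h
  rw [ht _ (CFC.sqrt z), ← mul_assoc, hm, mul_assoc, ht a, mul_assoc]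

/-- A maximal positive contraction `x` with `K τ(x) ≤ f(x)`: below `1 - x`, the functional `f` is
dominated by `K τ`. -/
theorem exists_le_mul_trace (hn : ScottContinuous τ)
    (hsup : ∀ D : Set A, D.Nonempty → DirectedOn (· ≤ ·) D → (∀ d ∈ D, 0 ≤ d) →
      (∀ d ∈ D, d ≤ 1) → ∃ s, IsLUB D s)
    (f : A →ₚ[ℂ] ℂ) {K : ℝ} (hK : 0 < K) :
    ∃ x : A, 0 ≤ x ∧ x ≤ 1 ∧ K * (τ x).re ≤ (f 1).re ∧
      ∀ y, 0 ≤ y → y ≤ 1 - x → (f y).re ≤ K * (τ y).re := by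
  -- The supremum of a chain keeps the inequality: `τ` is normal, and for `f` monotonicity suffices.
  obtain ⟨x, -, ⟨hx0, hx1, hx⟩, hmax⟩ := zorn_le_nonempty₀
    {x : A | 0 ≤ x ∧ x ≤ 1 ∧ K * (τ x).re ≤ (f x).re} (fun c hc hchain y hy => by
      obtain ⟨s, hs⟩ := hsup c ⟨y, hy⟩ hchain.directedOn (fun d hd => (hc hd).1)
        (fun d hd => (hc hd).2.1)
      refine ⟨s, ⟨(hc hy).1.trans (hs.1 hy), hs.2 fun d hd => (hc hd).2.1, ?_⟩, hs.1⟩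
      refine le_of_forall_pos_le_add fun δ hδ => ?_
      obtain ⟨d, hd, hlt⟩ := exists_lt_re_of_isLUB τ ⟨y, hy⟩ hchain.directedOn hs
        hn (div_pos hδ hK)
      have h1 := f.re_mono (hs.1 hd)
      have h2 := (hc hd).2.2
      have h3 := mul_lt_mul_of_pos_left hlt hK
      rw [mul_sub, mul_div_cancel₀ _ hK.ne'] at h3
      linarith) 0 (by simp [zero_le_one])
  refine ⟨x, hx0, hx1, hx.trans (f.re_mono hx1), fun y hy0 hy => ?_⟩
  by_contra! hlt
  -- A violating `y` could be added to `x`, against maximality.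
  have hxy : x + y ≤ x := hmax ⟨add_nonneg hx0 hy0, by simpa using add_le_add_right hy x, by
    simp only [map_add, Complex.add_re, mul_add]
    linarith⟩ (le_add_of_nonneg_right hy0)
  have : y = 0 := le_antisymm (by simpa using hxy) hy0
  simp [this] at hlt

/-- A positive functional becomes dominated by a multiple of the trace after compression by a
positive contraction that is close to `1` in `2`-norm. -/
theorem exists_contraction (ht : ∀ x y, τ (x * y) = τ (y * x))
    (hn : ScottContinuous τ)
    (hsup : ∀ D : Set A, D.Nonempty → DirectedOn (· ≤ ·) D → (∀ d ∈ D, 0 ≤ d) →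
      (∀ d ∈ D, d ≤ 1) → ∃ s, IsLUB D s)
    (f : A →ₚ[ℂ] ℂ) {ε : ℝ} (hε : 0 < ε) :
    ∃ a : A, 0 ≤ a ∧ ‖a‖ ≤ 1 ∧ (τ (star (1 - a) * (1 - a))).re ≤ ε ^ 2 ∧
      ∃ K : ℝ, 0 < K ∧ ∀ z, 0 ≤ z → (f (a * z * a)).re ≤ K * (τ z).re := by
  have hf1 : 0 ≤ (f 1).re := f.re_nonneg zero_le_one
  -- This `K` makes `K * τ x ≤ f 1` imply `τ x ≤ ε²`; the `+ 1` keeps it positive when `f 1 = 0`.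
  have hK : 0 < ((f 1).re + 1) / ε ^ 2 := by positivity
  obtain ⟨x, hx0, hx1, hx, hle⟩ := exists_le_mul_trace τ hn hsup f hK
  generalize hKe : ((f 1).re + 1) / ε ^ 2 = K at *
  have hb0 : 0 ≤ 1 - x := sub_nonneg.2 hx1
  have hb1 : 1 - x ≤ 1 := sub_le_self _ hx0
  set a := CFC.sqrt (1 - x) with ha
  have ha0 : 0 ≤ a := CFC.sqrt_nonneg _
  have hsa : IsSelfAdjoint a := .of_nonneg ha0
  have haa : a * a = 1 - x := CFC.sqrt_mul_sqrt_self _ hb0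
  have hnorm : ‖a‖ ≤ 1 := by
    have h1 : ‖a‖ * ‖a‖ = ‖1 - x‖ := by
      rw [← haa, ← CStarRing.norm_star_mul_self, hsa.star_eq]
    have h2 := (CStarAlgebra.norm_le_one_iff_of_nonneg _ hb0).2 hb1
    nlinarith [norm_nonneg a]
  have ha1 : a ≤ 1 := (CStarAlgebra.norm_le_one_iff_of_nonneg _ ha0).1 hnorm
  refine ⟨a, ha0, hnorm, ?_, K, hK, fun z hz => ?_⟩
  -- `(1 - a)² ≤ 1 - a ≤ 1 - a² = x`.
  · have h1 : (1 - a) * (1 - a) ≤ x := by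
      have e1 := mul_self_le_self (sub_nonneg.2 ha1) (sub_le_self _ ha0)
      have e2 := mul_self_le_self ha0 ha1
      rw [haa] at e2
      exact e1.trans (sub_le_comm.1 e2)
    have h2 := τ.re_mono h1
    rw [star_sub, star_one, hsa.star_eq]
    refine h2.trans ?_
    rw [← hKe, div_mul_eq_mul_div, div_le_iff₀ (by positivity)] at hx
    have hτ := τ.re_nonneg hx0
    by_contra! hlt
    nlinarith [mul_le_mul_of_nonneg_left hlt.le hf1]
  · rcases eq_or_ne z 0 with rfl | hz0
    · simp
    have hzn : 0 < ‖z‖ := norm_pos_iff.2 hz0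
    have h0 : 0 ≤ a * z * a := hsa.conjugate_nonneg hz
    -- Rescaling by `‖z‖⁻¹` puts `a * z * a` below `1 - x`, where `f` is dominated.
    have h1 : a * z * a ≤ ‖z‖ • (1 - x) := by
      have := CStarAlgebra.star_left_conjugate_le_norm_smul (a := a) (b := z) (.of_nonneg hz)
      rwa [hsa.star_eq, haa] at this
    have h2 := hle (‖z‖⁻¹ • (a * z * a)) (smul_nonneg (by positivity) h0) (by
      have := smul_le_smul_of_nonneg_left h1 (inv_nonneg.2 hzn.le)
      rwa [smul_smul, inv_mul_cancel₀ hzn.ne', one_smul] at this)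
    simp only [PositiveLinearMap.map_smul_of_tower, Complex.real_smul, Complex.re_ofReal_mul] at h2
    rw [mul_left_comm, mul_le_mul_iff_right₀ (by positivity)] at h2
    exact h2.trans (mul_le_mul_of_nonneg_left (re_conj_le τ ht (haa.trans_le hb1) hz) hK.le)

/-- A self-adjoint element that is nonnegative up to positive elements of arbitrarily small trace
is nonnegative. -/
theorem nonneg_of_forall_exists_add (ht : ∀ x y, τ (x * y) = τ (y * x))
    (hf : ∀ x, τ (star x * x) = 0 → x = 0)
    {h : A}
    (hk : ∀ δ > 0, ∃ k : A, 0 ≤ k ∧ (τ k).re ≤ δ ∧ 0 ≤ h + k) : 0 ≤ h := by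
  have hsa : IsSelfAdjoint h := by
    obtain ⟨k, hk0, -, hhk⟩ := hk 1 one_pos
    simpa using (IsSelfAdjoint.of_nonneg hhk).sub (.of_nonneg hk0)
  have hc : 0 ≤ h⁻ := CFC.negPart_nonneg h
  have hcs : IsSelfAdjoint h⁻ := .of_nonneg hc
  -- Conjugating `0 ≤ h + k` by `h⁻` therefore gives `τ (h⁻³) ≤ τ (h⁻ * k * h⁻) ≤ ‖h⁻ * h⁻‖ * τ k`,
  -- which is arbitrarily small.
  have hmul : h * h⁻ = - (h⁻ * h⁻) := by
    nth_rw 1 [← CFC.posPart_sub_negPart h hsa]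
    rw [sub_mul, CFC.posPart_mul_negPart, zero_sub]
  have hle : (τ (h⁻ * h⁻ * h⁻)).re ≤ 0 := by
    refine le_of_forall_pos_le_add fun δ hδ => ?_
    obtain ⟨k, hk0, hkδ, hhk⟩ := hk (δ / (‖h⁻ * h⁻‖ + 1)) (by positivity)
    have h1 := τ.re_nonneg (hcs.conjugate_nonneg hhk)
    have hks : IsSelfAdjoint (CFC.sqrt k) := .of_nonneg (CFC.sqrt_nonneg k)
    have hkm : CFC.sqrt k * CFC.sqrt k = k := CFC.sqrt_mul_sqrt_self k hk0
    have h2 : CFC.sqrt k * (h⁻ * h⁻) * CFC.sqrt k ≤ ‖h⁻ * h⁻‖ • k := by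
      have := CStarAlgebra.star_left_conjugate_le_norm_smul (a := CFC.sqrt k) (b := h⁻ * h⁻)
        (IsSelfAdjoint.of_nonneg (by simpa [hcs.star_eq] using star_mul_self_nonneg h⁻))
      rwa [hks.star_eq, hkm] at this
    have h3 := τ.re_mono h2
    rw [mul_assoc, ht (CFC.sqrt k), mul_assoc, hkm, mul_assoc, ht,
      PositiveLinearMap.map_smul_of_tower, Complex.real_smul, Complex.re_ofReal_mul] at h3
    rw [mul_add, add_mul, mul_assoc, hmul, map_add, Complex.add_re] at h1
    simp only [mul_neg, map_neg, Complex.neg_re] at h1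
    have h4 : ‖h⁻ * h⁻‖ * (τ k).re ≤ δ := by
      rw [le_div_iff₀ (by positivity)] at hkδ
      have := τ.re_nonneg hk0
      linarith
    rw [mul_assoc]
    linarith
  have hz : τ (h⁻ * h⁻ * h⁻) = 0 := by
    have := τ.map_nonneg (hcs.conjugate_nonneg hc)
    rw [Complex.le_def] at this
    exact Complex.ext (le_antisymm hle this.1) this.2.symm
  have hs : IsSelfAdjoint (CFC.sqrt h⁻) := .of_nonneg (CFC.sqrt_nonneg _)
  have hm : CFC.sqrt h⁻ * CFC.sqrt h⁻ = h⁻ := CFC.sqrt_mul_sqrt_self _ hc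
  -- With `y = √h⁻ * h⁻`, `star y * y = h⁻³` has trace zero, so faithfulness applies.
  have h5 : CFC.sqrt h⁻ * h⁻ = 0 := hf _ (by
    rw [star_mul, hs.star_eq, hcs.star_eq, mul_assoc, ← mul_assoc (CFC.sqrt h⁻), hm,
      ← mul_assoc, hz])
  have h6 : h⁻ = 0 := by
    have : star h⁻ * h⁻ = 0 := by
      rw [hcs.star_eq]; nth_rw 1 [← hm]; rw [mul_assoc, h5, mul_zero]
    exact CStarRing.star_mul_self_eq_zero_iff _ |>.1 this
  rw [← CFC.posPart_sub_negPart h hsa, h6, sub_zero]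
  exact CFC.posPart_nonneg h

/-- A positive map whose composition with the trace is dominated by the trace is normal. -/
theorem scottContinuous_of_le (ht : ∀ x y, τ (x * y) = τ (y * x))
    (hf : ∀ x, τ (star x * x) = 0 → x = 0)
    (hn : ScottContinuous τ) (ψ : A →ₚ[ℂ] A) {K : ℝ} (hK : 0 < K)
    (h : ∀ z, 0 ≤ z → (τ (ψ z)).re ≤ K * (τ z).re) : ScottContinuous ψ := by
  intro D hne hdir s hs
  refine ⟨?_, fun b hb => ?_⟩
  · rintro _ ⟨d, hd, rfl⟩
    exact ψ.monotone' (hs.1 hd)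
  · rw [← sub_nonneg]
    refine nonneg_of_forall_exists_add τ ht hf fun δ hδ => ?_
    obtain ⟨d, hd, hlt⟩ := exists_lt_re_of_isLUB τ hne hdir hs hn (div_pos hδ hK)
    have hds : 0 ≤ s - d := sub_nonneg.2 (hs.1 hd)
    -- The correction works because `b - ψ s + ψ (s - d) = b - ψ d ≥ 0`.
    refine ⟨ψ (s - d), ψ.map_nonneg hds, (h _ hds).trans ?_, ?_⟩
    · rw [← le_div_iff₀' hK, map_sub, Complex.sub_re]
      linarith
    · rw [map_sub, sub_add_sub_cancel]
      exact sub_nonneg.2 (hb ⟨d, hd, rfl⟩)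

/-- The positive map `x ↦ a x a` for self-adjoint `a`. -/
noncomputable def conjMap (a : A) (ha : IsSelfAdjoint a) : A →ₚ[ℂ] A :=
  .mk₀ (LinearMap.mulLeftRight ℂ (a, a)) fun x hx => by
    simpa [LinearMap.mulLeftRight_apply] using ha.conjugate_nonneg hx

end
end TracialVN

/-! ### Compressing the lift. -/

theorem mainTheorem3
    (𝒰 : Ultrafilter ℕ) (h𝒰 : (𝒰 : Filter ℕ) ≤ Filter.cofinite)
    {H : ℕ → Type u} [∀ i, NormedAddCommGroup (H i)] [∀ i, InnerProductSpace ℂ (H i)]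
    [∀ i, CompleteSpace (H i)]
    (M : ∀ i, VonNeumannAlgebra (H i)) (τ : ∀ i, TracialVN.FaithfulNormalTrace (M i))
    (hsep : ∀ i, (τ i).IsSeparable)
    (α : TracialVN.Ultraproduct M τ 𝒰 ≃⋆ₐ[ℂ] TracialVN.Ultraproduct M τ 𝒰)
    (hα : ∀ z, TracialVN.Ultraproduct.trace M τ 𝒰 (α z) = TracialVN.Ultraproduct.trace M τ 𝒰 z)
    (φ : ∀ i, TracialVN.Elem (M i) →ₚ[ℂ] TracialVN.Elem (M i))
    (hφ : TracialVN.UniformlyBounded φ) (hαφ : TracialVN.IsLift α φ) :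
    ∃ ψ : ∀ i, TracialVN.Elem (M i) →ₚ[ℂ] TracialVN.Elem (M i),
      TracialVN.UniformlyBounded ψ ∧ (∀ i, ScottContinuous (ψ i)) ∧ TracialVN.IsLift α ψ := by
  have hex : ∀ i, ∃ a : TracialVN.Elem (M i), 0 ≤ a ∧ ‖a‖ ≤ 1 ∧
      (τ i (star (1 - a) * (1 - a))).re ≤ (1 / ((i : ℝ) + 1)) ^ 2 ∧ ∃ K : ℝ, 0 < K ∧
        ∀ z, 0 ≤ z → (τ i (φ i (a * z * a))).re ≤ K * (τ i z).re := fun i =>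
    TracialVN.exists_contraction (τ i).toPositiveLinearMap (τ i).map_mul_comm' (τ i).normal'
      (fun _ hne hdir h0 h1 => TracialVN.Elem.exists_isLUB hne hdir h0 h1)
      ((τ i).toPositiveLinearMap.comp (φ i)) (by positivity)
  choose a ha0 ha1 haε K hK hle using hex
  have hsa : ∀ i, IsSelfAdjoint (a i) := fun i => .of_nonneg (ha0 i)
  have hnorm : ∀ i (x : TracialVN.Elem (M i)), ‖a i * x * a i‖ ≤ ‖x‖ := fun i x => by
    refine (norm_mul_le _ _).trans ((mul_le_of_le_one_right (norm_nonneg _) (ha1 i)).trans ?_)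
    exact (norm_mul_le _ _).trans (mul_le_of_le_one_left (norm_nonneg _) (ha1 i))
  refine ⟨fun i => (φ i).comp (TracialVN.conjMap (a i) (hsa i)), ?_, fun i => ?_, fun x => ?_⟩
  · obtain ⟨C, hC⟩ := hφ
    refine ⟨max C 0, fun i x => (hC i _).trans ?_⟩
    exact (mul_le_mul_of_nonneg_right (le_max_left _ _) (norm_nonneg _)).trans
      (mul_le_mul_of_nonneg_left (hnorm i x) (le_max_right _ _))
  · exact TracialVN.scottContinuous_of_le (τ i).toPositiveLinearMap (τ i).map_mul_comm'
      (τ i).faithful' (τ i).normal' _ (hK i) (hle i)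
  · let A : TracialVN.BoundedSeq M := ⟨a, 1, ha1⟩
    have hA : TracialVN.Ultraproduct.mk M τ 𝒰 A = 1 := by
      rw [← map_one (TracialVN.Ultraproduct.mk M τ 𝒰), eq_comm, TracialVN.Ultraproduct.mk_eq_mk_iff]
      -- Freeness of `𝒰` enters here: the errors `1 / (i + 1)` vanish along it.
      have hlim : Tendsto (fun i : ℕ => 1 / ((i : ℝ) + 1)) 𝒰 (𝓝 0) :=
        tendsto_one_div_add_atTop_nhds_zero_nat.mono_left (Nat.cofinite_eq_atTop ▸ h𝒰)
      exact squeeze_zero (fun i => (τ i).twoNorm_nonneg _)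
        (fun i => Real.sqrt_le_iff.2 ⟨by positivity, haε i⟩) hlim
    obtain ⟨y, hy, hαy⟩ := hαφ (A * x * A)
    refine ⟨y, hy, ?_⟩
    rw [← hαy, map_mul (TracialVN.Ultraproduct.mk M τ 𝒰), map_mul (TracialVN.Ultraproduct.mk M τ 𝒰), hA,
      one_mul, mul_one]
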